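/- Let $\mathcal N=\{1,\dots,n\}$ be a finite set of products and let $\mathcal S$ be a collection of subsets of $\mathcal N$ (assortments). A choice probability collection over $\mathcal S$ is $p_{\mathcal S}=(p_{i,S}: S\in\mathcal S,\ i\in S)$ with $p_{i,S}\ge 0$ and $\sum_{i\in S}p_{i,S}=1$ for all $S\in\mathcal S$. It is MDM-representable (representable by a marginal distribution model), written $p_{\mathcal S}\in\mathcal P_{\rm MDM}(\mathcal S)$, if there are deterministic utilities $\nu_1,\dots,\nu_n\in\mathbb R$ and marginal laws $F_1,\dots,F_n$ on $\mathbb R$, each absolutely continuous, with a distribution function that is strictly increasing on its support, and with finite first absolute moment, such that for every $S\in\mathcal S$ there is a joint law $\theta^*$ of $(\tilde\epsilon_1,\dots,\tilde\epsilon_n)$ with marginals $F_1,\dots,F_n$ which maximizes $\mathbb E_{\theta}\big[\max_{i\in S}(\nu_i+\tilde\epsilon_i)\big]$ over all joint laws $\theta$ with these marginals, and $p_{i,S}=\mathbb P_{\theta^*}\big(i=\arg\max_{j\in S}(\nu_j+\tilde\epsilon_j)\big)$ for all $i\in S$. Suppose that $p_{\mathcal S}\in\mathcal P_{\rm MDM}(\mathcal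 S)$, let $A\subseteq\mathcal N$ be a nonempty assortment with $A\notin\mathcal S$, and let $r_i\in(0,\infty)$ for $i\in\mathcal N$. Put $\mathcal S'=\mathcal S\cup\{A\}$ and let $\mathcal U_A=\{x_A=(x_{i,A}:i\in A): (p_{\mathcal S},x_A)\in\mathcal P_{\rm MDM}(\mathcal S')\}$ be the set of vectors for $A$ that are consistent with the data. Then $\mathcal U_A$ is nonempty, and the worst-case expected revenue $$\underline r(A)=\inf_{x_A\in\mathcal U_A}\ \sum_{i\in A}r_i x_{i,A}$$ is equal to the optimal value, which is attained, of the problem $$\begin{aligned}\min_{x_A\in\mathbb R^{A},\ \lambda\in\mathbb R^{\mathcal S'}}\ & \sum_{i\in A}r_i x_{i,A}\\ \text{s.t. } & x_{i,A}\le p_{i,S}\ \text{ if }\lambda_A\ge\lambda_S, && i\in A\cap S,\ S\in\mathcal S,\\ & x_{i,A}\ge p_{i,S}\ \text{ if }\lambda_A\le\lambda_S, && i\in A\cap S,\ S\in\mathcal S,\\ & \textstyle\sum_{i\in A}x_{i,A}=1,\quad x_{i,A}\ge 0, && i\in A,\\ & \lambda_S>\lambda_T\ \text{ if } p_{i,S}<p_{i,T},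 && i\in S\cap T,\ S,T\in\mathcal S,\\ & \lambda_S=\lambda_T\ \text{ if } p_{i,S}=p_{i,T}\ne 0, && i\in S\cap T,\ S,T\in\mathcal S.\end{aligned}$$ Moreover, the set of all $x_A$ for which some $\lambda\in\mathbb R^{\mathcal S'}$ satisfies these constraints is the closure of $\mathcal U_A$ in $\mathbb R^A$. -/

import Mathlib

open MeasureTheory ProbabilityTheory Set

/-- The standing assumption on the law `μ` of one stochastic utility term: an absolutely continuous
probability law whose distribution function is strictly increasing on its support and which has a
finite first absolute moment. -/
structure IsAdmissibleMarginal (μ : Measure ℝ) : Prop where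
  isProbabilityMeasure : IsProbabilityMeasure μ
  absolutelyContinuous : μ ≪ volume
  strictMonoOn_cdf : StrictMonoOn (cdf μ) μ.support
  integrable : Integrable (fun t : ℝ => t) μ

/-- The joint laws of the stochastic utility terms with the given marginal laws
(no assumption on their dependence). -/
def jointLaws {n : ℕ} (F : Fin n → Measure ℝ) : Set (Measure (Fin n → ℝ)) :=
  {θ | IsProbabilityMeasure θ ∧ ∀ i, θ.map (fun ε => ε i) = F i}

/-- Expected utility of the best product of the assortment `S`, under the joint law `θ`:
`E_θ[max_{i ∈ S} (ν_i + ε_i)]`. -/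
noncomputable def expectedMaxUtility {n : ℕ} (ν : Fin n → ℝ) (S : Finset (Fin n))
    (θ : Measure (Fin n → ℝ)) : ℝ :=
  ∫ ε, ⨆ i : S, (ν i + ε i) ∂θ

/-- The probability under `θ` that `i` is the utility maximizer in `S`. -/
noncomputable def choiceProb {n : ℕ} (ν : Fin n → ℝ) (S : Finset (Fin n))
    (θ : Measure (Fin n → ℝ)) (i : Fin n) : ℝ :=
  θ.real {ε | ∀ j ∈ S, j ≠ i → ν j + ε j < ν i + ε i}

/-- `q i`, `i ∈ S`, are the choice probabilities for the assortment `S` in the marginal distribution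
model with deterministic utilities `ν` and marginal laws `F`: the probabilities of being chosen
under a joint law that attains the largest expected maximal utility among all joint laws with
marginals `F`. -/
def IsMDMChoice {n : ℕ} (ν : Fin n → ℝ) (F : Fin n → Measure ℝ) (S : Finset (Fin n))
    (q : Fin n → ℝ) : Prop :=
  ∃ θ ∈ jointLaws F, IsMaxOn (expectedMaxUtility ν S) (jointLaws F) θ ∧
    ∀ i ∈ S, q i = choiceProb ν S θ i

/-- `p S i` (for `S ∈ 𝒮`, `i ∈ S`) is a collection of choice probabilities over `𝒮`.
Here and below only the entries `p S i` with `S ∈ 𝒮` and `i ∈ S` matter. -/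
def IsChoiceCollection {n : ℕ} (𝒮 : Finset (Finset (Fin n)))
    (p : Finset (Fin n) → Fin n → ℝ) : Prop :=
  ∀ S ∈ 𝒮, (∀ i ∈ S, 0 ≤ p S i) ∧ ∑ i ∈ S, p S i = 1

/-- The choice probability collection `p` over `𝒮` is representable by a marginal distribution
model: one choice of deterministic utilities and of admissible marginals explains all the
assortments in `𝒮`. -/
def IsMDMRepresentable {n : ℕ} (𝒮 : Finset (Finset (Fin n)))
    (p : Finset (Fin n) → Fin n → ℝ) : Prop :=
  IsChoiceCollection 𝒮 p ∧
    ∃ (ν : Fin n → ℝ) (F : Fin n → Measure ℝ), (∀ i, IsAdmissibleMarginal (F i)) ∧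
      ∀ S ∈ 𝒮, IsMDMChoice ν F S (p S)

/-- The collection `(p, x)`: the data `p` together with the vector `x` for the assortment `A`. -/
def extendData {n : ℕ} (p : Finset (Fin n) → Fin n → ℝ) (A : Finset (Fin n)) (x : A → ℝ) :
    Finset (Fin n) → Fin n → ℝ :=
  fun S i => if h : S = A ∧ i ∈ A then x ⟨i, h.2⟩ else p S i

/-- The choice probability vectors for the new assortment `A` that are consistent with the
data `p` over `𝒮` under the marginal distribution model. -/
def consistentSet {n : ℕ} (𝒮 : Finset (Finset (Fin n))) (p : Finset (Fin n) → Fin n → ℝ)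
    (A : Finset (Fin n)) : Set (A → ℝ) :=
  {x | IsMDMRepresentable (insert A 𝒮) (extendData p A x)}

/-- Expected revenue from the assortment `A`. -/
def revenue {n : ℕ} (r : Fin n → ℝ) (A : Finset (Fin n)) (x : A → ℝ) : ℝ :=
  ∑ i : A, r i * x i

/-- Worst-case expected revenue over the consistent choice probability vectors. -/
noncomputable def worstCaseRevenue {n : ℕ} (𝒮 : Finset (Finset (Fin n)))
    (p : Finset (Fin n) → Fin n → ℝ) (r : Fin n → ℝ) (A : Finset (Fin n)) : ℝ :=
  sInf (revenue r A '' consistentSet 𝒮 p A)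

/-- The constraints of the reformulation, in the variables `x` and `lam`
(only the values of `lam` on `𝒮 ∪ {A}` matter). -/
structure IsFeasible {n : ℕ} (𝒮 : Finset (Finset (Fin n))) (p : Finset (Fin n) → Fin n → ℝ)
    (A : Finset (Fin n)) (x : A → ℝ) (lam : Finset (Fin n) → ℝ) : Prop where
  le_data : ∀ S ∈ 𝒮, ∀ i : A, (i : Fin n) ∈ S → lam S ≤ lam A → x i ≤ p S i
  data_le : ∀ S ∈ 𝒮, ∀ i : A, (i : Fin n) ∈ S → lam A ≤ lam S → p S i ≤ x i
  sum_eq_one : ∑ i : A, x i = 1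
  nonneg : ∀ i : A, 0 ≤ x i
  lam_lt : ∀ S ∈ 𝒮, ∀ T ∈ 𝒮, ∀ i, i ∈ S → i ∈ T → p S i < p T i → lam T < lam S
  lam_eq : ∀ S ∈ 𝒮, ∀ T ∈ 𝒮, ∀ i, i ∈ S → i ∈ T → p S i = p T i → p S i ≠ 0 → lam S = lam T

/-! For every threshold `l`, `max_{i ∈ S} u i ≤ l + ∑_{i ∈ S} (u i - l)⁺`, with equality when
exactly one `u i` exceeds `l`. Taking expectations bounds the expected maximal utility, for every
coupling, by a number that depends on the marginals only. If `l` makes the probabilities of `ν i + ε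
i > l` sum to one over `S`, these events can be coupled so that exactly one of them occurs, and the
bound is attained. Every optimal coupling then has equality almost surely, so the choice probability
of `i` is `G i l`, the probability that `ν i + ε i > l`.

Thus the model says `p S i = G i (lam S)` with antitone `G i`, strictly decreasing where the value
lies in `(0, 1)`. This forces the order conditions on `lam`
(`IsMDMRepresentable.exists_isOrderCompatible`). Conversely, with `ν = 0`, data obeying them can be
interpolated by survival functions (`IsSurvivalData.exists_isAdmissibleMarginal`).

A feasible `x` need not be consistent, since `x i = p S i ≠ 0` is allowed with `lam A ≠ lam S`. But
curves through the data can pass arbitrarily near `x i` at `lam A`, and a change of threshold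
restores total probability one at small cost; hence `x` is a limit of consistent vectors
(`IsFeasible.mem_closure`). The feasible set is a finite union of polytopes, hence closed, so it is
exactly the closure. It is compact, and the continuous revenue attains on it the infimum over the
consistent set. -/

/-! ### Couplings under which exactly one event occurs -/

/-- The product law under which `i` is the only index in `S` whose coordinate lies in its event. -/
noncomputable def soloLaw {n : ℕ} (F : Fin n → Measure ℝ) (S : Finset (Fin n))
    (E : Fin n → Set ℝ) (i j : Fin n) : Measure ℝ :=
  if j ∈ S then if j = i then (F j)[|E j] else (F j)[|(E j)ᶜ] else F j

/-- Conditioning on the complement of `E j` degenerates only if `F j (E j) = 1`, and then the total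
mass one leaves nothing for `E i`. -/
lemma isProbabilityMeasure_soloLaw {n : ℕ} {F : Fin n → Measure ℝ} {S : Finset (Fin n)}
    {E : Fin n → Set ℝ} [∀ i, IsProbabilityMeasure (F i)] (hE : ∀ i, MeasurableSet (E i))
    (hsum : ∑ i ∈ S, F i (E i) = 1) {i : Fin n} (hi : i ∈ S) (hpos : F i (E i) ≠ 0) (j : Fin n) :
    IsProbabilityMeasure (soloLaw F S E i j) := by
  unfold soloLaw
  split_ifs with hj hji
  · subst hji
    exact cond_isProbabilityMeasure hpos
  · refine cond_isProbabilityMeasure fun h0 => ?_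
    have h1 : F j (E j) = 1 := by
      have := prob_compl_eq_zero_iff (μ := F j) (hE j)
      exact this.1 h0
    have h2 : F i (E i) + F j (E j) ≤ 1 := by
      rw [← hsum, ← Finset.sum_pair (f := fun k => F k (E k)) (Ne.symm hji)]
      refine Finset.sum_le_sum_of_subset ?_
      intro k hk
      rcases Finset.mem_insert.1 hk with rfl | hk
      · exact hi
      · rwa [Finset.mem_singleton.1 hk]
    rw [h1] at h2
    have h3 : F i (E i) + 1 ≤ 0 + 1 := by simpa using h2
    exact hpos (le_antisymm ((ENNReal.add_le_add_iff_right ENNReal.one_ne_top).1 h3) bot_le)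
  · infer_instance

/-- Mix the product laws `soloLaw F S E i` with weights `F i (E i)`. For `j ∈ S`, the components
with `i ≠ j` have total weight `F j (E j)ᶜ`, so the `j`-th marginal is `F j` reassembled from its
two conditional laws. -/
lemma exists_jointLaw_exactly_one {n : ℕ} (F : Fin n → Measure ℝ) (S : Finset (Fin n))
    (E : Fin n → Set ℝ) [∀ i, IsProbabilityMeasure (F i)] (hE : ∀ i, MeasurableSet (E i))
    (hsum : ∑ i ∈ S, F i (E i) = 1) :
    ∃ θ ∈ jointLaws F, ∀ᵐ ε ∂θ, ∃ i ∈ S, ε i ∈ E i ∧ ∀ j ∈ S, j ≠ i → ε j ∉ E j := by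
  have hfin : ∀ i j, IsFiniteMeasure (soloLaw F S E i j) := by
    intro i j
    unfold soloLaw
    split_ifs <;> infer_instance
  set θ : Measure (Fin n → ℝ) := ∑ i ∈ S, F i (E i) • Measure.pi (soloLaw F S E i) with hθ
  have key : ∀ j, ∀ s, MeasurableSet s → θ ((fun ε => ε j) ⁻¹' s) = F j s := by
    intro j s hs
    have h1 : θ ((fun ε => ε j) ⁻¹' s) = ∑ i ∈ S, F i (E i) * soloLaw F S E i j s := by
      rw [hθ, Measure.finsetSum_apply]
      refine Finset.sum_congr rfl fun i hi => ?_
      rw [Measure.smul_apply, smul_eq_mul]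
      by_cases hpos : F i (E i) = 0
      · simp [hpos]
      congr 1
      have := isProbabilityMeasure_soloLaw hE hsum hi hpos
      have h := (measurePreserving_eval (soloLaw F S E i) j).map_eq
      conv_rhs => rw [← h]
      rw [Measure.map_apply (measurable_pi_apply j) hs]
    rw [h1]
    by_cases hj : j ∈ S
    · rw [← Finset.add_sum_erase _ _ hj]
      have h2 : ∑ i ∈ S.erase j, F i (E i) * soloLaw F S E i j s
          = (F j (E j)ᶜ) * (F j)[|(E j)ᶜ] s := by
        rw [Finset.sum_congr rfl (g := fun i => F i (E i) * (F j)[|(E j)ᶜ] s), ← Finset.sum_mul]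
        · congr 1
          rw [prob_compl_eq_one_sub (hE j), ← hsum, ← Finset.add_sum_erase _ _ hj,
            ENNReal.add_sub_cancel_left (measure_ne_top _ _)]
        · intro i hi
          have : j ≠ i := fun h => (Finset.ne_of_mem_erase hi) h.symm
          simp [soloLaw, hj, this]
      rw [h2, ← cond_add_cond_compl_eq (hE j) (F j) (t := s)]
      simp [soloLaw, hj, mul_comm]
    · simp only [soloLaw, hj, if_false]
      rw [← Finset.sum_mul, hsum, one_mul]
  have hprob : IsProbabilityMeasure θ := by
    constructor
    rw [hθ, Measure.finsetSum_apply, ← hsum]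
    refine Finset.sum_congr rfl fun i hi => ?_
    rw [Measure.smul_apply, smul_eq_mul]
    by_cases hpos : F i (E i) = 0
    · simp [hpos]
    have := isProbabilityMeasure_soloLaw hE hsum hi hpos
    simp
  refine ⟨θ, ⟨hprob, fun i => ?_⟩, ?_⟩
  · ext s hs
    rw [Measure.map_apply (measurable_pi_apply i) hs, key i s hs]
  · rw [hθ, ae_finsetSum_measure_iff]
    intro i hi
    refine Measure.ae_smul_measure ?_ _
    have h : ∀ j, ∀ᵐ ε ∂(Measure.pi (soloLaw F S E i)), j ∈ S →
        if j = i then ε j ∈ E j else ε j ∉ E j := by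
      intro j
      have hbase : ∀ᵐ t ∂(soloLaw F S E i j), j ∈ S →
          if j = i then t ∈ E j else t ∉ E j := by
        by_cases hj : j ∈ S
        · by_cases hji : j = i
          · subst hji
            simpa [soloLaw, hj] using ae_cond_mem (μ := F j) (hE j)
          · simpa [soloLaw, hj, hji] using ae_cond_mem (μ := F j) (hE j).compl
        · simp [hj]
      exact (Measure.tendsto_eval_ae_ae (μ := soloLaw F S E i) (i := j)).eventually hbase
    filter_upwards [ae_all_iff.2 h] with ε hε
    refine ⟨i, hi, ?_, fun j hj hji => ?_⟩
    · simpa using hε i hi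
    · simpa [hji] using hε j hj

/-! ### Threshold duality for the expected maximal utility -/

/-- The upper bound on the expected maximal utility attached to the threshold `l`. -/
noncomputable def thresholdBound {n : ℕ} (ν : Fin n → ℝ) (F : Fin n → Measure ℝ)
    (S : Finset (Fin n)) (l : ℝ) : ℝ :=
  l + ∑ i ∈ S, ∫ t, max (ν i + t - l) 0 ∂(F i)

lemma iSup_le_threshold {n : ℕ} {S : Finset (Fin n)} (hS : S.Nonempty) (u : Fin n → ℝ) (l : ℝ) :
    ⨆ i : S, u i ≤ l + ∑ i ∈ S, max (u i - l) 0 := by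
  have : Nonempty S := hS.to_subtype
  refine ciSup_le fun i => ?_
  have := Finset.single_le_sum (f := fun i => max (u i - l) 0) (fun j _ => le_max_right _ _) i.2
  have h2 := le_max_left (u i - l) 0
  linarith

lemma iSup_eq_threshold {n : ℕ} {S : Finset (Fin n)} {u : Fin n → ℝ} {l : ℝ} {i : Fin n}
    (hi : i ∈ S) (hil : l < u i) (hj : ∀ j ∈ S, j ≠ i → u j ≤ l) :
    ⨆ i : S, u i = l + ∑ i ∈ S, max (u i - l) 0 := by
  refine le_antisymm (iSup_le_threshold ⟨i, hi⟩ u l) ?_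
  rw [Finset.sum_eq_single_of_mem i hi, max_eq_left (by linarith)]
  · have := le_ciSup (f := fun i : S => u i) (Set.finite_range _).bddAbove ⟨i, hi⟩
    linarith
  · intro j hjS hji
    exact max_eq_right (by linarith [hj j hjS hji])

lemma forall_lt_iff_of_iSup_eq_threshold {n : ℕ} {S : Finset (Fin n)} {u : Fin n → ℝ} {l : ℝ}
    (hne : ∀ i ∈ S, u i ≠ l) (h : ⨆ i : S, u i = l + ∑ i ∈ S, max (u i - l) 0)
    {i : Fin n} (hi : i ∈ S) : (∀ j ∈ S, j ≠ i → u j < u i) ↔ l < u i := by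
  have : Nonempty S := ⟨⟨i, hi⟩⟩
  obtain ⟨⟨k, hk⟩, hkmax⟩ := exists_eq_ciSup_of_finite (f := fun i : S => u i)
  simp only at hkmax
  rw [← hkmax, ← Finset.add_sum_erase _ _ hk] at h
  have hnn : 0 ≤ ∑ i ∈ S.erase k, max (u i - l) 0 :=
    Finset.sum_nonneg fun _ _ => le_max_right _ _
  have hlk : l < u k := by
    have := le_max_right (u k - l) 0
    exact lt_of_le_of_ne (by linarith) (hne k hk).symm
  rw [max_eq_left (by linarith)] at h
  have hz : ∀ j ∈ S.erase k, max (u j - l) 0 = 0 :=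
    (Finset.sum_eq_zero_iff_of_nonneg fun _ _ => le_max_right _ _).1 (by linarith)
  have hle : ∀ j ∈ S, j ≠ k → u j ≤ l := by
    intro j hj hjk
    have := le_max_left (u j - l) 0
    rw [hz j (Finset.mem_erase.2 ⟨hjk, hj⟩)] at this
    linarith
  constructor
  · intro hmax
    by_cases hik : k = i
    · exact hik ▸ hlk
    · exact hlk.trans (hmax k hk hik)
  · intro hli j hj hji
    have hik : i = k := by
      by_contra hik
      exact absurd (hle i hi hik) (not_le.2 hli)
    exact (hle j hj (hik ▸ hji)).trans_lt hli

lemma measurable_max_sub (c l : ℝ) : Measurable fun t : ℝ => max (c + t - l) 0 := by fun_prop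

lemma integrable_max_sub {μ : Measure ℝ} (hμ : IsAdmissibleMarginal μ) (c l : ℝ) :
    Integrable (fun t : ℝ => max (c + t - l) 0) μ := by
  have := hμ.isProbabilityMeasure
  exact (((integrable_const c).add hμ.integrable).sub (integrable_const l)).pos_part

lemma measurePreserving_coord {n : ℕ} {F : Fin n → Measure ℝ} {θ : Measure (Fin n → ℝ)}
    (hθ : θ ∈ jointLaws F) (i : Fin n) : MeasurePreserving (fun ε : Fin n → ℝ => ε i) θ (F i) :=
  ⟨measurable_pi_apply i, hθ.2 i⟩

lemma measurable_iSup_utility {n : ℕ} (ν : Fin n → ℝ) (S : Finset (Fin n)) :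
    Measurable fun ε : Fin n → ℝ => ⨆ i : S, (ν i + ε i) :=
  Measurable.iSup fun i => by fun_prop

lemma integrable_iSup_utility {n : ℕ} {ν : Fin n → ℝ} {F : Fin n → Measure ℝ}
    (hF : ∀ i, IsAdmissibleMarginal (F i)) {S : Finset (Fin n)} (hS : S.Nonempty)
    {θ : Measure (Fin n → ℝ)} (hθ : θ ∈ jointLaws F) :
    Integrable (fun ε => ⨆ i : S, (ν i + ε i)) θ := by
  have := hθ.1
  have hi : ∀ i, Integrable (fun ε : Fin n → ℝ => |ν i + ε i|) θ := fun i =>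
    (((integrable_const (ν i)).add
      ((measurePreserving_coord hθ i).integrable_comp_of_integrable (hF i).integrable))).abs
  refine Integrable.mono' (integrable_finsetSum S fun i _ => hi i)
    (measurable_iSup_utility ν S).aestronglyMeasurable (Filter.Eventually.of_forall fun ε => ?_)
  have : Nonempty S := hS.to_subtype
  obtain ⟨k, hk⟩ := exists_eq_ciSup_of_finite (f := fun i : S => ν i + ε i)
  rw [← hk, Real.norm_eq_abs]
  exact Finset.single_le_sum (f := fun i => |ν i + ε i|) (fun _ _ => abs_nonneg _) k.2

lemma integrable_threshold {n : ℕ} {ν : Fin n → ℝ} {F : Fin n → Measure ℝ}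
    (hF : ∀ i, IsAdmissibleMarginal (F i)) (S : Finset (Fin n)) (l : ℝ)
    {θ : Measure (Fin n → ℝ)} (hθ : θ ∈ jointLaws F) :
    Integrable (fun ε => l + ∑ i ∈ S, max (ν i + ε i - l) 0) θ := by
  have := hθ.1
  exact (integrable_const l).add (integrable_finsetSum S fun i _ =>
    (measurePreserving_coord hθ i).integrable_comp_of_integrable (integrable_max_sub (hF i) _ _))

lemma integral_threshold {n : ℕ} {ν : Fin n → ℝ} {F : Fin n → Measure ℝ}
    (hF : ∀ i, IsAdmissibleMarginal (F i)) (S : Finset (Fin n)) (l : ℝ)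
    {θ : Measure (Fin n → ℝ)} (hθ : θ ∈ jointLaws F) :
    ∫ ε, (l + ∑ i ∈ S, max (ν i + ε i - l) 0) ∂θ = thresholdBound ν F S l := by
  have := hθ.1
  have hi : ∀ i, Integrable (fun ε : Fin n → ℝ => max (ν i + ε i - l) 0) θ := fun i =>
    (measurePreserving_coord hθ i).integrable_comp_of_integrable (integrable_max_sub (hF i) _ _)
  rw [integral_add (integrable_const l) (integrable_finsetSum S fun i _ => hi i),
    integral_finsetSum S fun i _ => hi i, integral_const, thresholdBound]
  congr 1
  · simp
  · refine Finset.sum_congr rfl fun i _ => ?_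
    rw [← hθ.2 i, integral_map (measurable_pi_apply i).aemeasurable
      (measurable_max_sub _ _).aestronglyMeasurable]

lemma expectedMaxUtility_le {n : ℕ} {ν : Fin n → ℝ} {F : Fin n → Measure ℝ}
    (hF : ∀ i, IsAdmissibleMarginal (F i)) {S : Finset (Fin n)} (hS : S.Nonempty) (l : ℝ)
    {θ : Measure (Fin n → ℝ)} (hθ : θ ∈ jointLaws F) :
    expectedMaxUtility ν S θ ≤ thresholdBound ν F S l := by
  rw [← integral_threshold hF S l hθ]
  exact integral_mono (integrable_iSup_utility hF hS hθ) (integrable_threshold hF S l hθ)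
    fun ε => iSup_le_threshold hS (fun i => ν i + ε i) l

/-- Equal integrals of ordered functions force almost sure equality in the threshold inequality.
Ties with `l` are null by absolute continuity, so being the maximizer then means exceeding `l`. -/
lemma choiceProb_eq_of_expectedMaxUtility_eq {n : ℕ} {ν : Fin n → ℝ} {F : Fin n → Measure ℝ}
    (hF : ∀ i, IsAdmissibleMarginal (F i)) {S : Finset (Fin n)} {l : ℝ}
    {θ : Measure (Fin n → ℝ)} (hθ : θ ∈ jointLaws F)
    (h : expectedMaxUtility ν S θ = thresholdBound ν F S l) {i : Fin n} (hi : i ∈ S) :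
    choiceProb ν S θ i = (F i).real (Ioi (l - ν i)) := by
  have hS : S.Nonempty := ⟨i, hi⟩
  rw [← integral_threshold hF S l hθ, expectedMaxUtility,
    integral_eq_iff_of_ae_le (integrable_iSup_utility hF hS hθ) (integrable_threshold hF S l hθ)
      (Filter.Eventually.of_forall fun ε => iSup_le_threshold hS (fun i => ν i + ε i) l)] at h
  have hne : ∀ j, ∀ᵐ ε ∂θ, ν j + ε j ≠ l := by
    intro j
    have h0 : ∀ᵐ t ∂(F j), t ≠ l - ν j := by
      refine (hF j).absolutelyContinuous.ae_le ?_
      exact Measure.ae_ne volume _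
    filter_upwards [(measurePreserving_coord hθ j).quasiMeasurePreserving.ae h0] with ε hε h2
    exact hε (by linarith)
  rw [choiceProb, ← hθ.2 i, map_measureReal_apply (measurable_pi_apply i) measurableSet_Ioi]
  refine measureReal_congr ?_
  filter_upwards [h, ae_all_iff.2 hne] with ε hε hεne
  have := forall_lt_iff_of_iSup_eq_threshold (u := fun i => ν i + ε i) (fun j _ => hεne j) hε hi
  refine propext (this.trans ?_)
  change _ ↔ l - ν i < ε i
  exact sub_lt_iff_lt_add'.symm

lemma exists_expectedMaxUtility_eq {n : ℕ} {ν : Fin n → ℝ} {F : Fin n → Measure ℝ}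
    (hF : ∀ i, IsAdmissibleMarginal (F i)) {S : Finset (Fin n)} {l : ℝ}
    (hl : ∑ i ∈ S, (F i).real (Ioi (l - ν i)) = 1) :
    ∃ θ ∈ jointLaws F, expectedMaxUtility ν S θ = thresholdBound ν F S l := by
  have := fun i => (hF i).isProbabilityMeasure
  have hsum : ∑ i ∈ S, F i (Ioi (l - ν i)) = 1 := by
    rw [← ENNReal.ofReal_one, ← hl, ENNReal.ofReal_sum_of_nonneg fun _ _ => measureReal_nonneg]
    exact Finset.sum_congr rfl fun i _ => (ofReal_measureReal (measure_ne_top _ _)).symm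
  obtain ⟨θ, hθ, hae⟩ := exists_jointLaw_exactly_one F S (fun i => Ioi (l - ν i))
    (fun _ => measurableSet_Ioi) hsum
  refine ⟨θ, hθ, ?_⟩
  rw [← integral_threshold hF S l hθ, expectedMaxUtility]
  refine integral_congr_ae ?_
  filter_upwards [hae] with ε ⟨i, hi, hil, hj⟩
  refine iSup_eq_threshold (u := fun i => ν i + ε i) hi (sub_lt_iff_lt_add'.1 hil) ?_
  intro j hjS hji
  have := hj j hjS hji
  simp only [mem_Ioi, not_lt] at this
  linarith

lemma isMDMChoice_of_threshold {n : ℕ} {ν : Fin n → ℝ} {F : Fin n → Measure ℝ}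
    (hF : ∀ i, IsAdmissibleMarginal (F i)) {S : Finset (Fin n)} (hS : S.Nonempty) {l : ℝ}
    (hl : ∑ i ∈ S, (F i).real (Ioi (l - ν i)) = 1) {q : Fin n → ℝ}
    (hq : ∀ i ∈ S, q i = (F i).real (Ioi (l - ν i))) : IsMDMChoice ν F S q := by
  obtain ⟨θ, hθ, h⟩ := exists_expectedMaxUtility_eq hF hl
  refine ⟨θ, hθ, fun θ' hθ' => ?_, fun i hi => ?_⟩
  · rw [Set.mem_ofPred_eq, h]
    exact expectedMaxUtility_le hF hS l hθ'
  · rw [hq i hi, choiceProb_eq_of_expectedMaxUtility_eq hF hθ h hi]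

lemma IsMDMChoice.eq_of_threshold {n : ℕ} {ν : Fin n → ℝ} {F : Fin n → Measure ℝ}
    (hF : ∀ i, IsAdmissibleMarginal (F i)) {S : Finset (Fin n)} {l : ℝ}
    (hl : ∑ i ∈ S, (F i).real (Ioi (l - ν i)) = 1) {q : Fin n → ℝ}
    (hq : IsMDMChoice ν F S q) {i : Fin n} (hi : i ∈ S) :
    q i = (F i).real (Ioi (l - ν i)) := by
  obtain ⟨θ, hθ, hmax, hθq⟩ := hq
  obtain ⟨θ₀, hθ₀, h⟩ := exists_expectedMaxUtility_eq hF hl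
  rw [hθq i hi]
  refine choiceProb_eq_of_expectedMaxUtility_eq hF hθ ?_ hi
  exact le_antisymm (expectedMaxUtility_le hF ⟨i, hi⟩ l hθ) (h ▸ hmax hθ₀)

/-! ### Survival functions and the set of thresholds -/

lemma IsAdmissibleMarginal.measure_singleton {μ : Measure ℝ} (hμ : IsAdmissibleMarginal μ)
    (x : ℝ) : μ {x} = 0 := hμ.absolutelyContinuous Real.volume_singleton

lemma measureReal_Ioi_eq {μ : Measure ℝ} [IsProbabilityMeasure μ] (x : ℝ) :
    μ.real (Ioi x) = 1 - cdf μ x := by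
  rw [cdf_eq_real, ← compl_Iic, probReal_compl_eq_one_sub measurableSet_Iic]

lemma antitone_measureReal_Ioi (μ : Measure ℝ) [IsFiniteMeasure μ] :
    Antitone fun x => μ.real (Ioi x) :=
  fun _ _ h => measureReal_mono (Ioi_subset_Ioi h)

lemma IsAdmissibleMarginal.continuous_cdf {μ : Measure ℝ} (hμ : IsAdmissibleMarginal μ) :
    Continuous (cdf μ) := by
  have := hμ.isProbabilityMeasure
  rw [continuous_iff_continuousAt]
  intro x
  rw [(cdf μ).mono.continuousAt_iff_leftLim_eq_rightLim, StieltjesFunction.rightLim_eq]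
  refine le_antisymm ((cdf μ).mono.leftLim_le le_rfl) ?_
  have h := hμ.measure_singleton x
  rw [← measure_cdf μ, StieltjesFunction.measure_singleton, ENNReal.ofReal_eq_zero] at h
  linarith

lemma IsAdmissibleMarginal.continuous_measureReal_Ioi {μ : Measure ℝ}
    (hμ : IsAdmissibleMarginal μ) : Continuous fun x => μ.real (Ioi x) := by
  have := hμ.isProbabilityMeasure
  simp only [measureReal_Ioi_eq]
  exact continuous_const.sub hμ.continuous_cdf

lemma tendsto_measureReal_Ioi_atTop (μ : Measure ℝ) [IsProbabilityMeasure μ] :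
    Filter.Tendsto (fun x => μ.real (Ioi x)) Filter.atTop (nhds 0) := by
  simp only [measureReal_Ioi_eq]
  simpa using tendsto_const_nhds.sub (tendsto_cdf_atTop μ) (a := (1 : ℝ))

lemma tendsto_measureReal_Ioi_atBot (μ : Measure ℝ) [IsProbabilityMeasure μ] :
    Filter.Tendsto (fun x => μ.real (Ioi x)) Filter.atBot (nhds 1) := by
  simp only [measureReal_Ioi_eq]
  simpa using tendsto_const_nhds.sub (tendsto_cdf_atBot μ) (a := (1 : ℝ))

/-- The survival function is strictly decreasing where it takes values in `(0, 1)`. -/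
lemma IsAdmissibleMarginal.measureReal_Ioi_lt {μ : Measure ℝ} (hμ : IsAdmissibleMarginal μ)
    {x y : ℝ} (hxy : x < y) (h0 : 0 < μ.real (Ioi y)) (h1 : μ.real (Ioi x) < 1) :
    μ.real (Ioi y) < μ.real (Ioi x) := by
  have := hμ.isProbabilityMeasure
  have hx : 0 < μ (Iic x) := by
    rw [measureReal_Ioi_eq, cdf_eq_real] at h1
    by_contra h
    have : μ.real (Iic x) = 0 := by
      rw [measureReal_def, le_antisymm (not_lt.1 h) bot_le]; rfl
    linarith
  have hy : 0 < μ (Ici y) := by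
    refine lt_of_lt_of_le ?_ (measure_mono Ioi_subset_Ici_self)
    exact pos_iff_ne_zero.2 fun h => by simp [measureReal_def, h] at h0
  have hxne : (Iic x ∩ μ.support).Nonempty := Measure.nonempty_inter_support_of_pos hx
  have hyne : (Ici y ∩ μ.support).Nonempty := Measure.nonempty_inter_support_of_pos hy
  have hxb : BddAbove (Iic x ∩ μ.support) := ⟨x, fun z hz => hz.1⟩
  have hyb : BddBelow (Ici y ∩ μ.support) := ⟨y, fun z hz => hz.1⟩
  obtain ⟨hx1, hx2⟩ := (isClosed_Iic.inter Measure.isClosed_support).csSup_mem hxne hxb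
  obtain ⟨hy1, hy2⟩ := (isClosed_Ici.inter Measure.isClosed_support).csInf_mem hyne hyb
  -- Strict monotonicity is assumed on the support only, so `x` and `y` are moved outwards to the
  -- nearest support points. The intervals crossed carry no mass.
  set x' := sSup (Iic x ∩ μ.support)
  set y' := sInf (Ici y ∩ μ.support)
  have hlt := hμ.strictMonoOn_cdf hx2 hy2 (hx1.trans_lt (hxy.trans_le hy1))
  have hnull : μ (Ioc x' x ∪ Ioc y y') = 0 := by
    refine measure_mono_null (t := μ.supportᶜ ∪ {y'}) ?_
      (measure_union_null Measure.measure_compl_support (hμ.measure_singleton y'))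
    rintro z (hz | hz)
    · left
      intro hzs
      exact absurd (le_csSup hxb ⟨hz.2, hzs⟩) (not_le.2 hz.1)
    · by_cases hzy : z = y'
      · exact Or.inr hzy
      · left
        intro hzs
        exact hzy (le_antisymm hz.2 (csInf_le hyb ⟨hz.1.le, hzs⟩))
  have e1 : μ.real (Iic x) ≤ μ.real (Iic x') := by
    rw [← Iic_union_Ioc_eq_Iic hx1]
    refine (measureReal_union_le _ _).trans ?_
    rw [measureReal_def μ (Ioc x' x), measure_mono_null subset_union_left hnull]
    simp
  have e2 : μ.real (Iic y') ≤ μ.real (Iic y) := by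
    rw [← Iic_union_Ioc_eq_Iic hy1]
    refine (measureReal_union_le _ _).trans ?_
    rw [measureReal_def μ (Ioc y y'), measure_mono_null subset_union_right hnull]
    simp
  rw [measureReal_Ioi_eq, measureReal_Ioi_eq]
  rw [cdf_eq_real, cdf_eq_real] at *
  linarith

/-- The values at which the thresholded choice probabilities sum to one. -/
def thresholdSet {n : ℕ} (ν : Fin n → ℝ) (F : Fin n → Measure ℝ) (S : Finset (Fin n)) : Set ℝ :=
  {l | ∑ i ∈ S, (F i).real (Ioi (l - ν i)) = 1}

lemma continuous_sum_measureReal_Ioi {n : ℕ} {ν : Fin n → ℝ} {F : Fin n → Measure ℝ}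
    (hF : ∀ i, IsAdmissibleMarginal (F i)) (S : Finset (Fin n)) :
    Continuous fun l => ∑ i ∈ S, (F i).real (Ioi (l - ν i)) :=
  continuous_finsetSum _ fun i _ =>
    (hF i).continuous_measureReal_Ioi.comp (continuous_id.sub continuous_const)

lemma tendsto_sum_measureReal_Ioi_atTop {n : ℕ} {ν : Fin n → ℝ} {F : Fin n → Measure ℝ}
    (hF : ∀ i, IsAdmissibleMarginal (F i)) (S : Finset (Fin n)) :
    Filter.Tendsto (fun l => ∑ i ∈ S, (F i).real (Ioi (l - ν i))) Filter.atTop (nhds 0) := by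
  have := fun i => (hF i).isProbabilityMeasure
  rw [← Finset.sum_const_zero (s := S)]
  exact tendsto_finsetSum _ fun i _ => (tendsto_measureReal_Ioi_atTop (F i)).comp
    (Filter.tendsto_atTop_add_const_right _ (-ν i) Filter.tendsto_id)

lemma tendsto_sum_measureReal_Ioi_atBot {n : ℕ} {ν : Fin n → ℝ} {F : Fin n → Measure ℝ}
    (hF : ∀ i, IsAdmissibleMarginal (F i)) (S : Finset (Fin n)) :
    Filter.Tendsto (fun l => ∑ i ∈ S, (F i).real (Ioi (l - ν i))) Filter.atBot
      (nhds (S.card : ℝ)) := by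
  have := fun i => (hF i).isProbabilityMeasure
  rw [← nsmul_one S.card, ← Finset.sum_const]
  exact tendsto_finsetSum _ fun i _ => (tendsto_measureReal_Ioi_atBot (F i)).comp
    (Filter.tendsto_atBot_add_const_right _ (-ν i) Filter.tendsto_id)

lemma nonempty_thresholdSet {n : ℕ} {ν : Fin n → ℝ} {F : Fin n → Measure ℝ}
    (hF : ∀ i, IsAdmissibleMarginal (F i)) {S : Finset (Fin n)} {a : ℝ}
    (ha : 1 ≤ ∑ i ∈ S, (F i).real (Ioi (a - ν i))) : (thresholdSet ν F S).Nonempty := by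
  obtain ⟨b, hb⟩ := ((tendsto_sum_measureReal_Ioi_atTop hF S (ν := ν)).eventually
    (eventually_le_nhds zero_lt_one)).exists
  obtain ⟨l, hl⟩ := mem_range_of_exists_le_of_exists_ge
    (continuous_sum_measureReal_Ioi hF S (ν := ν)) ⟨b, hb⟩ ⟨a, ha⟩
  exact ⟨l, hl⟩

/-- The total survival probability is continuous and runs from `S.card` down to `0`, so it can miss
the value one only if `S.card ≤ 1`. -/
lemma eq_singleton_of_thresholdSet_eq_empty {n : ℕ} {ν : Fin n → ℝ} {F : Fin n → Measure ℝ}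
    (hF : ∀ i, IsAdmissibleMarginal (F i)) {S : Finset (Fin n)}
    (h : thresholdSet ν F S = ∅) {i : Fin n} (hi : i ∈ S) : S = {i} := by
  by_contra hne
  have hcard : 1 < S.card := by
    have h1 : 1 ≤ S.card := Finset.card_pos.2 ⟨i, hi⟩
    refine lt_of_le_of_ne h1 fun h2 => ?_
    obtain ⟨j, rfl⟩ := Finset.card_eq_one.1 h2.symm
    exact hne (by rw [Finset.mem_singleton.1 hi])
  have hcard' : (1 : ℝ) < S.card := by exact_mod_cast hcard
  obtain ⟨a, ha⟩ := ((tendsto_sum_measureReal_Ioi_atBot hF S (ν := ν)).eventually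
    (eventually_ge_nhds hcard')).exists
  exact (nonempty_thresholdSet hF ha).ne_empty h

lemma isClosed_thresholdSet {n : ℕ} {ν : Fin n → ℝ} {F : Fin n → Measure ℝ}
    (hF : ∀ i, IsAdmissibleMarginal (F i)) (S : Finset (Fin n)) : IsClosed (thresholdSet ν F S) :=
  isClosed_eq (continuous_sum_measureReal_Ioi hF S) continuous_const

lemma bddAbove_thresholdSet {n : ℕ} {ν : Fin n → ℝ} {F : Fin n → Measure ℝ}
    (hF : ∀ i, IsAdmissibleMarginal (F i)) (S : Finset (Fin n)) : BddAbove (thresholdSet ν F S) := by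
  obtain ⟨b, hb⟩ := Filter.eventually_atTop.1
    ((tendsto_sum_measureReal_Ioi_atTop hF S (ν := ν)).eventually (eventually_lt_nhds zero_lt_one))
  refine ⟨b, fun l hl => ?_⟩
  by_contra hlb
  have := hb l (not_le.1 hlb).le
  exact this.ne hl

lemma csSup_mem_thresholdSet {n : ℕ} {ν : Fin n → ℝ} {F : Fin n → Measure ℝ}
    (hF : ∀ i, IsAdmissibleMarginal (F i)) {S : Finset (Fin n)} (h : (thresholdSet ν F S).Nonempty) :
    sSup (thresholdSet ν F S) ∈ thresholdSet ν F S :=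
  (isClosed_thresholdSet hF S).csSup_mem h (bddAbove_thresholdSet hF S)

/-- The largest threshold makes `lam` well determined. Beyond it a survival value in `(0, 1)` cannot
persist. If the value is one, all other products of `S` already have value zero, so `b` would be a
larger threshold. -/
lemma csSup_thresholdSet_le {n : ℕ} {ν : Fin n → ℝ} {F : Fin n → Measure ℝ}
    (hF : ∀ i, IsAdmissibleMarginal (F i)) {S : Finset (Fin n)} (hS : (thresholdSet ν F S).Nonempty)
    {i : Fin n} (hiS : i ∈ S) {b : ℝ} (hb : 0 < (F i).real (Ioi (b - ν i)))
    (h : (F i).real (Ioi (sSup (thresholdSet ν F S) - ν i)) = (F i).real (Ioi (b - ν i))) :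
    b ≤ sSup (thresholdSet ν F S) := by
  have := fun i => (hF i).isProbabilityMeasure
  by_contra hlt
  rw [not_le] at hlt
  have hmem : ∑ i ∈ S, (F i).real (Ioi (sSup (thresholdSet ν F S) - ν i)) = 1 :=
    csSup_mem_thresholdSet hF hS
  set a := sSup (thresholdSet ν F S) with ha
  rcases (measureReal_le_one (μ := F i) (s := Ioi (a - ν i))).lt_or_eq with h1 | h1
  · exact ((hF i).measureReal_Ioi_lt (sub_lt_sub_right hlt _) hb h1).ne h.symm
  · rw [← Finset.add_sum_erase _ _ hiS, h1] at hmem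
    have hz := (Finset.sum_eq_zero_iff_of_nonneg fun _ _ => measureReal_nonneg).1
      (by linarith : ∑ j ∈ S.erase i, (F j).real (Ioi (a - ν j)) = 0)
    have hbmem : b ∈ thresholdSet ν F S := by
      change ∑ i ∈ S, (F i).real (Ioi (b - ν i)) = 1
      rw [← Finset.add_sum_erase _ _ hiS, ← h, h1, Finset.sum_eq_zero, add_zero]
      intro j hj
      refine le_antisymm ?_ measureReal_nonneg
      rw [← hz j hj]
      exact antitone_measureReal_Ioi (F j) (sub_le_sub_right hlt.le _)
    exact absurd (le_csSup (bddAbove_thresholdSet hF S) hbmem) (not_le.2 hlt)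

/-! ### Necessity of the order conditions -/

/-- The order conditions on `lam` that characterise representability of `p`. -/
structure IsOrderCompatible {n : ℕ} (𝒮 : Finset (Finset (Fin n)))
    (p : Finset (Fin n) → Fin n → ℝ) (lam : Finset (Fin n) → ℝ) : Prop where
  lam_lt : ∀ S ∈ 𝒮, ∀ T ∈ 𝒮, ∀ i, i ∈ S → i ∈ T → p S i < p T i → lam T < lam S
  lam_eq : ∀ S ∈ 𝒮, ∀ T ∈ 𝒮, ∀ i, i ∈ S → i ∈ T → p S i = p T i → p S i ≠ 0 → lam S = lam T

lemma IsMDMRepresentable.exists_isOrderCompatible {n : ℕ} {𝒮 : Finset (Finset (Fin n))}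
    {p : Finset (Fin n) → Fin n → ℝ} (hp : IsMDMRepresentable 𝒮 p) :
    ∃ lam, IsOrderCompatible 𝒮 p lam := by
  obtain ⟨hcol, ν, F, hF, hch⟩ := hp
  have := fun i => (hF i).isProbabilityMeasure
  obtain ⟨m, hm⟩ : ∃ m : ℝ, ∀ S ∈ 𝒮, m < sSup (thresholdSet ν F S) := by
    obtain ⟨m, hm⟩ := (𝒮.image fun S => sSup (thresholdSet ν F S)).bddBelow
    refine ⟨m - 1, fun S hS => ?_⟩
    have := hm (Finset.mem_coe.2 (Finset.mem_image_of_mem _ hS))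
    linarith
  have hle : ∀ S ∈ 𝒮, ∀ i ∈ S, p S i ≤ 1 := fun S hS i hi => by
    rw [← (hcol S hS).2]
    exact Finset.single_le_sum (f := p S) (fun j hj => (hcol S hS).1 j hj) hi
  have hone : ∀ S ∈ 𝒮, thresholdSet ν F S = ∅ → ∀ i ∈ S, p S i = 1 := by
    intro S hS he i hi
    have h1 := (hcol S hS).2
    rw [eq_singleton_of_thresholdSet_eq_empty hF he hi] at h1
    rw [← h1, eq_singleton_of_thresholdSet_eq_empty hF he hi, Finset.sum_singleton]
  have hval : ∀ S ∈ 𝒮, (thresholdSet ν F S).Nonempty → ∀ i ∈ S,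
      p S i = (F i).real (Ioi (sSup (thresholdSet ν F S) - ν i)) := fun S hS hne i hi =>
    (hch S hS).eq_of_threshold hF (csSup_mem_thresholdSet hF hne) hi
  -- Here `T = {i}`; equal values would make the threshold of `S` a threshold of `T`.
  have hmixed : ∀ S ∈ 𝒮, ∀ T ∈ 𝒮, ∀ i, i ∈ S → i ∈ T → (thresholdSet ν F S).Nonempty →
      thresholdSet ν F T = ∅ → p S i ≠ p T i := by
    intro S hS T hT i hiS hiT hne he heq
    rw [hone T hT he i hiT, hval S hS hne i hiS] at heq
    have hmem : sSup (thresholdSet ν F S) ∈ thresholdSet ν F T := by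
      rw [eq_singleton_of_thresholdSet_eq_empty hF he hiT]
      simpa [thresholdSet] using heq
    rw [he] at hmem
    exact hmem
  classical
  -- Without a threshold, `S` is a singleton whose survival function reaches one only at `-∞`; `m`,
  -- below all other values, stands in for `-∞`.
  refine ⟨fun S => if thresholdSet ν F S = ∅ then m else sSup (thresholdSet ν F S), ?_, ?_⟩
  · intro S hS T hT i hiS hiT hlt
    by_cases h1 : thresholdSet ν F S = ∅
    · rw [hone S hS h1 i hiS] at hlt
      exact absurd (hle T hT i hiT) (not_le.2 hlt)
    by_cases h2 : thresholdSet ν F T = ∅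
    · simpa [h1, h2] using hm S hS
    · simp only [h1, h2, if_false]
      by_contra hle
      rw [hval S hS (nonempty_iff_ne_empty.2 h1) i hiS,
        hval T hT (nonempty_iff_ne_empty.2 h2) i hiT] at hlt
      exact absurd (antitone_measureReal_Ioi (F i) (sub_le_sub_right (not_lt.1 hle) _))
        (not_le.2 hlt)
  · intro S hS T hT i hiS hiT heq hne
    by_cases h1 : thresholdSet ν F S = ∅ <;> by_cases h2 : thresholdSet ν F T = ∅
    · simp [h1, h2]
    · exact absurd heq.symm (hmixed T hT S hS i hiT hiS (nonempty_iff_ne_empty.2 h2) h1)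
    · exact absurd heq (hmixed S hS T hT i hiS hiT (nonempty_iff_ne_empty.2 h1) h2)
    · simp only [h1, h2, if_false]
      have n1 := nonempty_iff_ne_empty.2 h1
      have n2 := nonempty_iff_ne_empty.2 h2
      have hpos : 0 < p S i := lt_of_le_of_ne ((hcol S hS).1 i hiS) hne.symm
      have e1 := hval S hS n1 i hiS
      have e2 := hval T hT n2 i hiT
      exact le_antisymm
        (csSup_thresholdSet_le hF n2 hiT (e1 ▸ hpos) (by rw [← e1, ← e2, heq]))
        (csSup_thresholdSet_le hF n1 hiS (e2 ▸ heq ▸ hpos) (by rw [← e1, ← e2, heq]))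

/-! ### Admissible laws from bilipschitz decreasing functions -/

/-- `H` is decreasing with all difference quotients between two negative constants. -/
structure IsBilipschitzAnti (H : ℝ → ℝ) : Prop where
  lower : ∃ δ > 0, ∀ x y, x ≤ y → δ * (y - x) ≤ H x - H y
  upper : ∃ C : NNReal, ∀ x y, x ≤ y → H x - H y ≤ C * (y - x)

lemma IsBilipschitzAnti.strictAnti {H : ℝ → ℝ} (hH : IsBilipschitzAnti H) : StrictAnti H := by
  obtain ⟨δ, hδ, h⟩ := hH.lower
  intro x y hxy
  have := h x y hxy.le
  have := mul_pos hδ (sub_pos.2 hxy)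
  linarith

lemma IsBilipschitzAnti.exists_lipschitzWith {H : ℝ → ℝ} (hH : IsBilipschitzAnti H) :
    ∃ C, LipschitzWith C H := by
  obtain ⟨C, h⟩ := hH.upper
  refine ⟨C, LipschitzWith.of_dist_le_mul fun x y => ?_⟩
  rw [Real.dist_eq, Real.dist_eq]
  rcases le_total x y with hxy | hxy
  · rw [abs_of_nonneg (sub_nonneg.2 (hH.strictAnti.antitone hxy)),
      abs_of_nonpos (sub_nonpos.2 hxy), neg_sub]
    exact h x y hxy
  · rw [abs_of_nonpos (sub_nonpos.2 (hH.strictAnti.antitone hxy)), neg_sub,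
      abs_of_nonneg (sub_nonneg.2 hxy)]
    exact h y x hxy

lemma IsBilipschitzAnti.surjective {H : ℝ → ℝ} (hH : IsBilipschitzAnti H) :
    Function.Surjective H := by
  obtain ⟨C, hC⟩ := hH.exists_lipschitzWith
  obtain ⟨δ, hδ, h⟩ := hH.lower
  intro v
  refine mem_range_of_exists_le_of_exists_ge hC.continuous
    ⟨max 0 ((H 0 - v) / δ), ?_⟩ ⟨min 0 ((H 0 - v) / δ), ?_⟩
  · have h1 := h 0 _ (le_max_left 0 ((H 0 - v) / δ))
    have h2 := mul_le_mul_of_nonneg_left (le_max_right 0 ((H 0 - v) / δ)) hδ.le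
    rw [mul_div_cancel₀ _ hδ.ne'] at h2
    linarith
  · have h1 := h _ 0 (min_le_left 0 ((H 0 - v) / δ))
    have h2 := mul_le_mul_of_nonneg_left (min_le_right 0 ((H 0 - v) / δ)) hδ.le
    rw [mul_div_cancel₀ _ hδ.ne'] at h2
    linarith

/-- Interpolation of finitely many strictly decreasing values. -/
lemma exists_isBilipschitzAnti_interpolation {ι : Type*} (s : Finset ι) (lam h : ι → ℝ)
    (hlt : ∀ a ∈ s, ∀ b ∈ s, lam a < lam b → h b < h a)
    (heq : ∀ a ∈ s, ∀ b ∈ s, lam a = lam b → h a = h b) :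
    ∃ H, IsBilipschitzAnti H ∧ ∀ a ∈ s, H (lam a) = h a := by
  classical
  induction s using Finset.induction_on_max_value lam with
  | empty =>
    refine ⟨fun x => -x, ⟨⟨1, one_pos, fun x y _ => ?_⟩, ⟨1, fun x y _ => ?_⟩⟩, by simp⟩ <;>
    · simp
  | insert a s ha hmax ih =>
    obtain ⟨H, hH, hHs⟩ := ih
      (fun b hb c hc => hlt b (Finset.mem_insert_of_mem hb) c (Finset.mem_insert_of_mem hc))
      (fun b hb c hc => heq b (Finset.mem_insert_of_mem hb) c (Finset.mem_insert_of_mem hc))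
    rcases s.eq_empty_or_nonempty with rfl | hs
    · refine ⟨fun x => h a + lam a - x,
        ⟨⟨1, one_pos, fun x y _ => ?_⟩, ⟨1, fun x y _ => ?_⟩⟩, by simp⟩ <;>
      · simp
    obtain ⟨b, hb, hbmax⟩ := s.exists_max_image lam hs
    have hbi := Finset.mem_insert_of_mem (b := a) hb
    have hai := Finset.mem_insert_self a s
    rcases (hmax b hb).eq_or_lt with hab | hab
    · refine ⟨H, hH, fun c hc => ?_⟩
      rcases Finset.mem_insert.1 hc with rfl | hc
      · rw [← hab, hHs b hb, heq b hbi c hai hab]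
      · exact hHs c hc
    have hd : 0 < lam a - lam b := sub_pos.2 hab
    set k := (h b - h a) / (lam a - lam b) with hk
    have hkpos : 0 < k := div_pos (sub_pos.2 (hlt b hbi a hai hab)) hd
    have hsplit : ∀ x : ℝ, min x (lam b) + max (x - lam b) 0 = x := by
      intro x
      rcases le_total x (lam b) with hx | hx
      · rw [min_eq_left hx, max_eq_right (by linarith)]; ring
      · rw [min_eq_right hx, max_eq_left (by linarith)]; ring
    -- Keep `H` up to the previous rightmost node `lam b` and continue with slope `-k`, chosen to
    -- hit the new rightmost node.
    refine ⟨fun x => H (min x (lam b)) - k * max (x - lam b) 0, ⟨?_, ?_⟩, ?_⟩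
    · obtain ⟨δ, hδ, hl⟩ := hH.lower
      refine ⟨min δ k, lt_min hδ hkpos, fun x y hxy => ?_⟩
      have m1 : min x (lam b) ≤ min y (lam b) := min_le_min_right _ hxy
      have m2 : max (x - lam b) 0 ≤ max (y - lam b) 0 := max_le_max_right _ (by linarith)
      have e1 := hl _ _ m1
      have e2 := mul_le_mul_of_nonneg_right (min_le_left δ k) (sub_nonneg.2 m1)
      have e3 := mul_le_mul_of_nonneg_right (min_le_right δ k) (sub_nonneg.2 m2)
      calc min δ k * (y - x) = min δ k * (min y (lam b) - min x (lam b)) +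
            min δ k * (max (y - lam b) 0 - max (x - lam b) 0) := by
              conv_lhs => rw [← hsplit x, ← hsplit y]
              ring
        _ ≤ _ := by linarith
    · obtain ⟨C, hu⟩ := hH.upper
      refine ⟨max C k.toNNReal, fun x y hxy => ?_⟩
      have m1 : min x (lam b) ≤ min y (lam b) := min_le_min_right _ hxy
      have m2 : max (x - lam b) 0 ≤ max (y - lam b) 0 := max_le_max_right _ (by linarith)
      have e1 := hu _ _ m1
      have e2 := mul_le_mul_of_nonneg_right (le_max_left (C : ℝ) k) (sub_nonneg.2 m1)
      have e3 := mul_le_mul_of_nonneg_right (le_max_right (C : ℝ) k) (sub_nonneg.2 m2)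
      rw [NNReal.coe_max, Real.coe_toNNReal k hkpos.le]
      calc _ ≤ max (C : ℝ) k * (min y (lam b) - min x (lam b)) +
            max (C : ℝ) k * (max (y - lam b) 0 - max (x - lam b) 0) := by linarith
        _ = _ := by
              conv_rhs => rw [← hsplit x, ← hsplit y]
              ring
    · intro c hc
      dsimp only
      rcases Finset.mem_insert.1 hc with rfl | hc
      · rw [min_eq_right hab.le, max_eq_left hd.le, hHs b hb, hk, div_mul_cancel₀ _ hd.ne']
        ring
      · rw [min_eq_left (hbmax c hc), max_eq_right (by linarith [hbmax c hc]), hHs c hc]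
        ring

/-- Truncation to the unit interval. -/
noncomputable def clampUnit (v : ℝ) : ℝ := max (min 1 v) 0

/-- The law is the image of the uniform law on `(0, 1)` under `Q = H⁻¹`. It lives on the compact
interval `[Q 1, Q 0]`, where no truncation occurs, whence strictness and integrability. -/
lemma IsBilipschitzAnti.exists_isAdmissibleMarginal {H : ℝ → ℝ} (hH : IsBilipschitzAnti H) :
    ∃ μ, IsAdmissibleMarginal μ ∧ (∃ m, μ.real (Ioi m) = 1) ∧
      ∀ x, μ.real (Ioi x) = clampUnit (H x) := by
  set e := Equiv.ofBijective H ⟨hH.strictAnti.injective, hH.surjective⟩ with he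
  set Q : ℝ → ℝ := fun u => e.symm u with hQ
  have hHQ : ∀ u, H (Q u) = u := fun u => e.apply_symm_apply u
  have hltQ : ∀ x u, x < Q u ↔ u < H x := by
    intro x u
    conv_rhs => rw [← hHQ u]
    exact hH.strictAnti.lt_iff_gt.symm
  have hQanti : StrictAnti Q := fun u v huv => by
    rw [hltQ, hHQ]; exact huv
  have hQm : Measurable Q := hQanti.antitone.measurable
  have hprob : IsProbabilityMeasure (volume.restrict (Ioo (0 : ℝ) 1)) := ⟨by simp⟩
  set μ : Measure ℝ := (volume.restrict (Ioo (0 : ℝ) 1)).map Q with hμ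
  have hμp : IsProbabilityMeasure μ := Measure.isProbabilityMeasure_map hQm.aemeasurable
  have hval : ∀ x, μ.real (Ioi x) = clampUnit (H x) := by
    intro x
    have : Q ⁻¹' (Ioi x) = Iio (H x) := by
      ext u; exact hltQ x u
    rw [hμ, map_measureReal_apply hQm measurableSet_Ioi, this,
      measureReal_restrict_apply measurableSet_Iio, inter_comm, Ioo_inter_Iio,
      Real.volume_real_Ioo, sub_zero, clampUnit]
  refine ⟨μ, ⟨hμp, ?_, ?_, ?_⟩, ⟨Q 1, by rw [hval, hHQ, clampUnit]; simp⟩, hval⟩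
  · refine Measure.AbsolutelyContinuous.mk fun s hs h0 => ?_
    rw [hμ, Measure.map_apply hQm hs]
    refine Measure.absolutelyContinuous_of_le Measure.restrict_le_self ?_
    -- Absolute continuity: the preimage under `Q` is the image under the Lipschitz map `H`, which
    -- preserves null sets.
    have himg : Q ⁻¹' s = H '' s := (e.image_eq_preimage_symm s).symm
    obtain ⟨C, hC⟩ := hH.exists_lipschitzWith
    have h := (hC.lipschitzOnWith (s := s)).hausdorffMeasure_image_le (d := 1) zero_le_one
    rw [hausdorffMeasure_real, h0, mul_zero] at h
    rw [himg]
    exact le_antisymm h bot_le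
  · have hsupp : μ.support ⊆ Icc (Q 1) (Q 0) := by
      refine Measure.support_subset_of_isClosed isClosed_Icc ?_
      rw [hμ, mem_ae_map_iff hQm.aemeasurable measurableSet_Icc]
      filter_upwards [ae_restrict_mem measurableSet_Ioo] with u hu
      exact ⟨hQanti.antitone hu.2.le, hQanti.antitone hu.1.le⟩
    intro x hx y hy hxy
    have hclamp : ∀ z ∈ Icc (Q 1) (Q 0), clampUnit (H z) = H z := by
      intro z hz
      have h1 := hH.strictAnti.antitone hz.1
      have h2 := hH.strictAnti.antitone hz.2
      rw [hHQ] at h1 h2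
      rw [clampUnit, min_eq_right h1, max_eq_left h2]
    have hx' := hval x
    have hy' := hval y
    rw [measureReal_Ioi_eq, hclamp _ (hsupp hx)] at hx'
    rw [measureReal_Ioi_eq, hclamp _ (hsupp hy)] at hy'
    have := hH.strictAnti hxy
    linarith
  · rw [hμ, integrable_map_measure (g := fun t : ℝ => t) measurable_id.aestronglyMeasurable
      hQm.aemeasurable]
    refine Integrable.mono' (integrable_const (max |Q 1| |Q 0|)) hQm.aestronglyMeasurable ?_
    filter_upwards [ae_restrict_mem measurableSet_Ioo] with u hu
    exact abs_le_max_abs_abs (hQanti.antitone hu.2.le) (hQanti.antitone hu.1.le)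

/-! ### Interpolating data by survival functions -/

/-- Values `g` that can be interpolated by an admissible survival function at the points `lam`. -/
structure IsSurvivalData {ι : Type*} (s : Finset ι) (lam g : ι → ℝ) : Prop where
  mem_Icc : ∀ a ∈ s, g a ∈ Icc (0 : ℝ) 1
  lt : ∀ a ∈ s, ∀ b ∈ s, g a < g b → lam b < lam a
  eq : ∀ a ∈ s, ∀ b ∈ s, g a = g b → g a ≠ 0 → lam a = lam b

/-- Only the value zero may recur at different `lam`. Replacing it by `c - lam a ≤ 0` makes the data
strictly decreasing, and truncation undoes the change. -/
lemma IsSurvivalData.exists_unclamped {ι : Type*} {s : Finset ι} {lam g : ι → ℝ}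
    (hg : IsSurvivalData s lam g) :
    ∃ h : ι → ℝ, (∀ a ∈ s, ∀ b ∈ s, lam a < lam b → h b < h a) ∧
      (∀ a ∈ s, ∀ b ∈ s, lam a = lam b → h a = h b) ∧
      (∀ a ∈ s, clampUnit (h a) = g a) ∧ ∀ a ∈ s, h a ≤ g a := by
  classical
  obtain ⟨c, hc⟩ := (s.image lam).bddBelow
  have hc' : ∀ a ∈ s, c ≤ lam a := fun a ha => hc (Finset.mem_coe.2 (Finset.mem_image_of_mem _ ha))
  refine ⟨fun a => if 0 < g a then g a else c - lam a, ?_, ?_, ?_, ?_⟩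
  · intro a ha b hb hab
    have h1 : g b ≤ g a := not_lt.1 fun h => (hg.lt a ha b hb h).not_gt hab
    have h2 := (hg.mem_Icc b hb).1
    have h3 := (hg.mem_Icc a ha).1
    rcases h3.eq_or_lt with h3 | h3
    · have h4 : g b = 0 := le_antisymm (h3 ▸ h1) h2
      simpa [← h3, h4] using hab
    · have hne : g b ≠ g a := fun h => hab.ne (hg.eq a ha b hb h.symm h3.ne')
      have hlt := lt_of_le_of_ne h1 hne
      simp only [h3, if_true]
      split_ifs
      · exact hlt
      · linarith [hc' b hb]
  · intro a ha b hb hab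
    have h1 : g a = g b := by
      rcases lt_trichotomy (g a) (g b) with h | h | h
      · exact absurd hab (hg.lt a ha b hb h).ne'
      · exact h
      · exact absurd hab (hg.lt b hb a ha h).ne
    simp [h1, hab]
  · intro a ha
    obtain ⟨h1, h2⟩ := hg.mem_Icc a ha
    simp only [clampUnit]
    split_ifs with h
    · rw [min_eq_right h2, max_eq_left h1]
    · rw [max_eq_right ((min_le_right _ _).trans (by linarith [hc' a ha]))]
      linarith
  · intro a ha
    dsimp only
    split_ifs with h
    · exact le_rfl
    · linarith [hc' a ha, (hg.mem_Icc a ha).1]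

lemma IsSurvivalData.exists_isAdmissibleMarginal {ι : Type*} {s : Finset ι} {lam g : ι → ℝ}
    (hg : IsSurvivalData s lam g) :
    ∃ μ, IsAdmissibleMarginal μ ∧ (∃ m, μ.real (Ioi m) = 1) ∧
      ∀ a ∈ s, μ.real (Ioi (lam a)) = g a := by
  obtain ⟨h, hlt, heq, hclamp, -⟩ := hg.exists_unclamped
  obtain ⟨H, hH, hHs⟩ := exists_isBilipschitzAnti_interpolation s lam h hlt heq
  obtain ⟨μ, hμ, hm, hval⟩ := hH.exists_isAdmissibleMarginal
  exact ⟨μ, hμ, hm, fun a ha => by rw [hval, hHs a ha, hclamp a ha]⟩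

lemma abs_clampUnit_sub_le {x v ε : ℝ} (hx : x ∈ Icc (0 : ℝ) 1) (h1 : x - ε ≤ v)
    (h2 : v ≤ x + ε) : |clampUnit v - x| ≤ ε := by
  obtain ⟨hx0, hx1⟩ := hx
  rw [abs_le, clampUnit]
  constructor
  · have : x - ε ≤ min 1 v := le_min (by linarith) h1
    linarith [le_max_left (min 1 v) 0]
  · have : max (min 1 v) 0 ≤ x + ε := max_le ((min_le_right _ _).trans h2) (by linarith)
    linarith

/-- If `x` is weakly compatible with the data at the point `lam a`, then an interpolating
survival function can be chosen to pass as close to `x` as desired. -/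
lemma IsSurvivalData.exists_isAdmissibleMarginal_near {ι : Type*} {s : Finset ι}
    {lam g : ι → ℝ} (hg : IsSurvivalData s lam g) {a : ι} (ha : a ∉ s) {x : ℝ}
    (hx : x ∈ Icc (0 : ℝ) 1) (hle : ∀ b ∈ s, lam b ≤ lam a → x ≤ g b)
    (hge : ∀ b ∈ s, lam a ≤ lam b → g b ≤ x) {ε : ℝ} (hε : 0 < ε) :
    ∃ μ, IsAdmissibleMarginal μ ∧ (∃ m, μ.real (Ioi m) = 1) ∧
      (∀ b ∈ s, μ.real (Ioi (lam b)) = g b) ∧ |μ.real (Ioi (lam a)) - x| ≤ ε := by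
  classical
  by_cases hex : ∃ b ∈ s, lam b = lam a
  · obtain ⟨b, hb, hba⟩ := hex
    obtain ⟨μ, hμ, hm, hval⟩ := hg.exists_isAdmissibleMarginal
    refine ⟨μ, hμ, hm, hval, ?_⟩
    rw [← hba, hval b hb, le_antisymm (hge b hb hba.ge) (hle b hb hba.le), sub_self, abs_zero]
    exact hε.le
  push Not at hex
  obtain ⟨h, hlt, heq, hclamp, hhg⟩ := hg.exists_unclamped
  obtain ⟨v, hv1, hv2, hvx⟩ : ∃ v, (∀ b ∈ s, lam a < lam b → h b < v) ∧
      (∀ b ∈ s, lam b < lam a → v < h b) ∧ |clampUnit v - x| ≤ ε := by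
    have hlohi : ∀ y ∈ (s.filter fun b => lam a < lam b).image h,
        ∀ z ∈ (s.filter fun b => lam b < lam a).image h, y < z := by
      simp only [Finset.mem_image, Finset.mem_filter]
      rintro _ ⟨b, ⟨hb, hab⟩, rfl⟩ _ ⟨c, ⟨hc, hca⟩, rfl⟩
      exact hlt c hc b hb (hca.trans hab)
    -- If every lifted value to the left is at least `x`, some `v` within `ε` of `x` fits between
    -- the neighbours. Otherwise a lifted value `h c < x` is nonpositive, so `x = g c = 0`, and any
    -- fitting `v` is negative and truncates to `x`.
    by_cases hall : ∀ b ∈ s, lam b < lam a → x ≤ h b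
    · obtain ⟨v, hv1, hv2⟩ := Order.exists_between_finsets
        (insert (x - ε) ((s.filter fun b => lam a < lam b).image h))
        (insert (x + ε) ((s.filter fun b => lam b < lam a).image h)) (by
          intro y hy z hz
          rcases Finset.mem_insert.1 hy with rfl | hy <;>
            rcases Finset.mem_insert.1 hz with rfl | hz
          · linarith
          · simp only [Finset.mem_image, Finset.mem_filter] at hz
            obtain ⟨c, ⟨hc, hca⟩, rfl⟩ := hz
            linarith [hall c hc hca]
          · simp only [Finset.mem_image, Finset.mem_filter] at hy
            obtain ⟨b, ⟨hb, hab⟩, rfl⟩ := hy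
            linarith [hhg b hb, hge b hb hab.le]
          · exact hlohi y hy z hz)
      refine ⟨v, fun b hb hab => hv1 _ ?_, fun b hb hba => hv2 _ ?_,
        abs_clampUnit_sub_le hx (hv1 _ (Finset.mem_insert_self _ _)).le
          (hv2 _ (Finset.mem_insert_self _ _)).le⟩
      · exact Finset.mem_insert_of_mem
          (Finset.mem_image_of_mem _ (Finset.mem_filter.2 ⟨hb, hab⟩))
      · exact Finset.mem_insert_of_mem
          (Finset.mem_image_of_mem _ (Finset.mem_filter.2 ⟨hb, hba⟩))
    · push Not at hall
      obtain ⟨c, hc, hca, hcx⟩ := hall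
      obtain ⟨v, hv1, hv2⟩ := Order.exists_between_finsets _ _ hlohi
      have hvc : v < h c := hv2 _ (Finset.mem_image_of_mem _ (Finset.mem_filter.2 ⟨hc, hca⟩))
      have hxc := hle c hc hca.le
      rw [← hclamp c hc, clampUnit] at hxc
      have hhc : h c ≤ 0 := by
        by_contra hpos
        have := max_le (min_le_right 1 (h c)) (not_le.1 hpos).le
        linarith
      rw [max_eq_right ((min_le_right _ _).trans hhc)] at hxc
      refine ⟨v, fun b hb hab => hv1 _ ?_, fun b hb hba => hv2 _ ?_, ?_⟩
      · exact Finset.mem_image_of_mem _ (Finset.mem_filter.2 ⟨hb, hab⟩)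
      · exact Finset.mem_image_of_mem _ (Finset.mem_filter.2 ⟨hb, hba⟩)
      · rw [clampUnit, max_eq_right ((min_le_right _ _).trans (by linarith)),
          le_antisymm hxc hx.1]
        simpa using hε.le
  have hup : ∀ b ∈ s, Function.update h a v b = h b := fun b hb =>
    Function.update_of_ne (by rintro rfl; exact ha hb) _ _
  obtain ⟨H, hH, hHs⟩ := exists_isBilipschitzAnti_interpolation (insert a s) lam
    (Function.update h a v) (by
      intro b hb c hc hbc
      rcases Finset.mem_insert.1 hb with rfl | hb' <;>
        rcases Finset.mem_insert.1 hc with rfl | hc'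
      · exact absurd hbc (lt_irrefl _)
      · rw [hup c hc', Function.update_self]
        exact hv1 c hc' hbc
      · rw [hup b hb', Function.update_self]
        exact hv2 b hb' hbc
      · rw [hup b hb', hup c hc']
        exact hlt b hb' c hc' hbc) (by
      intro b hb c hc hbc
      rcases Finset.mem_insert.1 hb with rfl | hb' <;>
        rcases Finset.mem_insert.1 hc with rfl | hc'
      · rfl
      · exact absurd hbc.symm (hex c hc')
      · exact absurd hbc (hex b hb')
      · rw [hup b hb', hup c hc']
        exact heq b hb' c hc' hbc)
  obtain ⟨μ, hμ, hm, hval⟩ := hH.exists_isAdmissibleMarginal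
  refine ⟨μ, hμ, hm, fun b hb => ?_, ?_⟩
  · rw [hval, hHs b (Finset.mem_insert_of_mem hb), hup b hb, hclamp b hb]
  · rw [hval, hHs a (Finset.mem_insert_self a s), Function.update_self]
    exact hvx

/-! ### Consistent vectors and their closure -/

section Extension

variable {n : ℕ} {𝒮 : Finset (Finset (Fin n))} {p : Finset (Fin n) → Fin n → ℝ}
  {A : Finset (Fin n)}

lemma extendData_of_ne {S : Finset (Fin n)} (h : S ≠ A) (x : A → ℝ) :
    extendData p A x S = p S := by
  funext i
  simp [extendData, h]

lemma extendData_self (x : A → ℝ) (i : A) : extendData p A x A i = x i := by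
  simp [extendData]

lemma IsChoiceCollection.mem_Icc (hp : IsChoiceCollection 𝒮 p) {S : Finset (Fin n)} (hS : S ∈ 𝒮)
    {i : Fin n} (hi : i ∈ S) : p S i ∈ Icc (0 : ℝ) 1 := by
  refine ⟨(hp S hS).1 i hi, ?_⟩
  rw [← (hp S hS).2]
  exact Finset.single_le_sum (f := p S) (fun j hj => (hp S hS).1 j hj) hi

lemma IsChoiceCollection.nonempty (hp : IsChoiceCollection 𝒮 p) {S : Finset (Fin n)}
    (hS : S ∈ 𝒮) : S.Nonempty := by
  rw [Finset.nonempty_iff_ne_empty]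
  rintro rfl
  simpa using (hp ∅ hS).2

lemma IsOrderCompatible.isSurvivalData (hcol : IsChoiceCollection 𝒮 p)
    {lam : Finset (Fin n) → ℝ} (hlam : IsOrderCompatible 𝒮 p lam) (i : Fin n) :
    IsSurvivalData (𝒮.filter fun S => i ∈ S) lam (fun S => p S i) := by
  constructor
  · intro S hS
    rw [Finset.mem_filter] at hS
    exact hcol.mem_Icc hS.1 hS.2
  · intro S hS T hT h
    rw [Finset.mem_filter] at hS hT
    exact hlam.lam_lt S hS.1 T hT.1 i hS.2 hT.2 h
  · intro S hS T hT h
    rw [Finset.mem_filter] at hS hT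
    exact hlam.lam_eq S hS.1 T hT.1 i hS.2 hT.2 h

lemma IsFeasible.isOrderCompatible {x : A → ℝ} {lam : Finset (Fin n) → ℝ}
    (h : IsFeasible 𝒮 p A x lam) : IsOrderCompatible 𝒮 p lam := ⟨h.lam_lt, h.lam_eq⟩

/-- The weak inequalities on `x` are contrapositives of the strict order conditions between `A` and
the assortments in `𝒮`. -/
lemma exists_isFeasible_of_mem_consistentSet (hA𝒮 : A ∉ 𝒮) {x : A → ℝ}
    (hx : x ∈ consistentSet 𝒮 p A) : ∃ lam, IsFeasible 𝒮 p A x lam := by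
  obtain ⟨lam, hlam⟩ := IsMDMRepresentable.exists_isOrderCompatible hx
  have hcol : IsChoiceCollection (insert A 𝒮) (extendData p A x) := hx.1
  have hne : ∀ S ∈ 𝒮, S ≠ A := by
    rintro S hS rfl
    exact hA𝒮 hS
  have hA := Finset.mem_insert_self A 𝒮
  have hmem : ∀ S ∈ 𝒮, S ∈ insert A 𝒮 := fun S hS => Finset.mem_insert_of_mem hS
  refine ⟨lam, ?_, ?_, ?_, ?_, ?_, ?_⟩
  · intro S hS i hi hle
    have := hlam.lam_lt S (hmem S hS) A hA i hi i.2
    rw [extendData_of_ne (hne S hS), extendData_self] at this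
    by_contra h
    exact (this (not_le.1 h)).not_ge hle
  · intro S hS i hi hle
    have := hlam.lam_lt A hA S (hmem S hS) i i.2 hi
    rw [extendData_of_ne (hne S hS), extendData_self] at this
    by_contra h
    exact (this (not_le.1 h)).not_ge hle
  · rw [← (hcol A hA).2, ← Finset.sum_coe_sort A]
    exact Finset.sum_congr rfl fun i _ => (extendData_self x i).symm
  · intro i
    rw [← extendData_self (p := p) x i]
    exact (hcol A hA).1 i i.2
  · intro S hS T hT i
    have := hlam.lam_lt S (hmem S hS) T (hmem T hT) i
    rwa [extendData_of_ne (hne S hS), extendData_of_ne (hne T hT)] at this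
  · intro S hS T hT i
    have := hlam.lam_eq S (hmem S hS) T (hmem T hT) i
    rwa [extendData_of_ne (hne S hS), extendData_of_ne (hne T hT)] at this

/-- Survival functions through the data produce consistent vectors for the new assortment. -/
lemma mem_consistentSet_of_survival (hcol : IsChoiceCollection 𝒮 p) (hA : A.Nonempty)
    (hA𝒮 : A ∉ 𝒮) {F : Fin n → Measure ℝ} (hF : ∀ i, IsAdmissibleMarginal (F i))
    {lam : Finset (Fin n) → ℝ} (hlam : ∀ S ∈ 𝒮, ∀ i ∈ S, (F i).real (Ioi (lam S)) = p S i)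
    {t : ℝ} (ht : ∑ i ∈ A, (F i).real (Ioi t) = 1) :
    (fun i : A => (F i).real (Ioi t)) ∈ consistentSet 𝒮 p A := by
  have hne : ∀ S ∈ 𝒮, S ≠ A := by
    rintro S hS rfl
    exact hA𝒮 hS
  have hext : ∀ i ∈ A, extendData p A (fun i : A => (F i).real (Ioi t)) A i
      = (F i).real (Ioi t) := fun i hi => extendData_self (p := p) _ ⟨i, hi⟩
  refine ⟨fun S hS => ?_, 0, F, hF, fun S hS => ?_⟩
  · rcases Finset.mem_insert.1 hS with rfl | hS
    · refine ⟨fun i hi => ?_, ?_⟩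
      · rw [hext i hi]
        exact measureReal_nonneg
      · rw [← ht]
        exact Finset.sum_congr rfl hext
    · rw [extendData_of_ne (hne S hS)]
      exact hcol S hS
  · rcases Finset.mem_insert.1 hS with rfl | hS
    · refine isMDMChoice_of_threshold (l := t) hF hA ?_ fun i hi => ?_
      · simpa using ht
      · simpa using hext i hi
    · rw [extendData_of_ne (hne S hS)]
      refine isMDMChoice_of_threshold (l := lam S) hF (hcol.nonempty hS) ?_ fun i hi => ?_
      · rw [← (hcol S hS).2]
        exact Finset.sum_congr rfl fun i hi => by simpa using hlam S hS i hi
      · simpa using (hlam S hS i hi).symm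

/-- All survival functions move in the same direction, so a threshold with total probability one
moves each of them by at most the defect of the total probability. -/
lemma exists_threshold_abs_sub_le {F : Fin n → Measure ℝ} (hF : ∀ i, IsAdmissibleMarginal (F i))
    (hl : (thresholdSet 0 F A).Nonempty) (s : ℝ) :
    ∃ t, ∑ i ∈ A, (F i).real (Ioi t) = 1 ∧ ∀ i ∈ A,
      |(F i).real (Ioi t) - (F i).real (Ioi s)| ≤ |1 - ∑ i ∈ A, (F i).real (Ioi s)| := by
  have := fun i => (hF i).isProbabilityMeasure
  obtain ⟨t, ht⟩ := hl
  have ht' : ∑ i ∈ A, (F i).real (Ioi t) = 1 := by simpa [thresholdSet] using ht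
  refine ⟨t, ht', fun i hi => ?_⟩
  rw [← ht', ← Finset.sum_sub_distrib]
  rcases le_total t s with h | h
  · have hnn : ∀ j ∈ A, 0 ≤ (F j).real (Ioi t) - (F j).real (Ioi s) := fun j _ =>
      sub_nonneg.2 (antitone_measureReal_Ioi (F j) h)
    rw [abs_of_nonneg (hnn i hi), abs_of_nonneg (Finset.sum_nonneg hnn)]
    exact Finset.single_le_sum (f := fun j => (F j).real (Ioi t) - (F j).real (Ioi s)) hnn hi
  · have hnn : ∀ j ∈ A, 0 ≤ (F j).real (Ioi s) - (F j).real (Ioi t) := fun j _ =>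
      sub_nonneg.2 (antitone_measureReal_Ioi (F j) h)
    rw [abs_sub_comm, abs_of_nonneg (hnn i hi), ← abs_neg, ← Finset.sum_neg_distrib]
    simp only [neg_sub]
    rw [abs_of_nonneg (Finset.sum_nonneg hnn)]
    exact Finset.single_le_sum (f := fun j => (F j).real (Ioi s) - (F j).real (Ioi t)) hnn hi

/-- The hypothesis `hone` ensures a threshold for `A` even when `A` is a singleton. -/
lemma exists_survival_through_data (hcol : IsChoiceCollection 𝒮 p) (hA : A.Nonempty)
    (hA𝒮 : A ∉ 𝒮) {F : Fin n → Measure ℝ} (hF : ∀ i, IsAdmissibleMarginal (F i))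
    (hone : ∀ i, ∃ m, (F i).real (Ioi m) = 1)
    {lam : Finset (Fin n) → ℝ} (hlam : ∀ S ∈ 𝒮, ∀ i ∈ S, (F i).real (Ioi (lam S)) = p S i)
    (s : ℝ) :
    ∃ y ∈ consistentSet 𝒮 p A, ∀ i : A,
      |y i - (F i).real (Ioi s)| ≤ |1 - ∑ i ∈ A, (F i).real (Ioi s)| := by
  have hl : (thresholdSet 0 F A).Nonempty := by
    obtain ⟨i, hi⟩ := hA
    obtain ⟨m, hm⟩ := hone i
    refine nonempty_thresholdSet hF (a := m) ?_
    rw [← hm]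
    simpa using Finset.single_le_sum (f := fun i => (F i).real (Ioi m))
      (fun _ _ => measureReal_nonneg) hi
  obtain ⟨t, ht, habs⟩ := exists_threshold_abs_sub_le hF hl s
  exact ⟨_, mem_consistentSet_of_survival hcol hA hA𝒮 hF hlam ht, fun i => habs i i.2⟩

lemma consistentSet_nonempty (hp : IsMDMRepresentable 𝒮 p) (hA : A.Nonempty) (hA𝒮 : A ∉ 𝒮) :
    (consistentSet 𝒮 p A).Nonempty := by
  obtain ⟨lam, hlam⟩ := hp.exists_isOrderCompatible
  choose F hF hone hval using fun i =>
    (hlam.isSurvivalData hp.1 i).exists_isAdmissibleMarginal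
  obtain ⟨y, hy, -⟩ := exists_survival_through_data hp.1 hA hA𝒮 hF hone
    (fun S hS i hi => hval i S (Finset.mem_filter.2 ⟨hS, hi⟩)) 0
  exact ⟨y, hy⟩

lemma IsFeasible.mem_closure (hcol : IsChoiceCollection 𝒮 p) (hA : A.Nonempty) (hA𝒮 : A ∉ 𝒮)
    {x : A → ℝ} {lam : Finset (Fin n) → ℝ} (h : IsFeasible 𝒮 p A x lam) :
    x ∈ closure (consistentSet 𝒮 p A) := by
  rw [Metric.mem_closure_iff]
  intro ε hε
  -- The defect of the total is at most `A.card * δ` and the curve's own error at most `δ`; one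
  -- spare `δ` makes the final bound strict.
  set δ := ε / (A.card + 2) with hδ
  have hcard : (0 : ℝ) < A.card + 2 := by positivity
  have hδpos : 0 < δ := div_pos hε hcard
  have hx1 : ∀ i, x i ≤ 1 := fun i => by
    rw [← h.sum_eq_one]
    exact Finset.single_le_sum (fun j _ => h.nonneg j) (Finset.mem_univ i)
  have hcurve : ∀ i, ∃ μ, IsAdmissibleMarginal μ ∧ (∃ m, μ.real (Ioi m) = 1) ∧
      (∀ S ∈ 𝒮.filter fun S => i ∈ S, μ.real (Ioi (lam S)) = p S i) ∧
      ∀ hi : i ∈ A, |μ.real (Ioi (lam A)) - x ⟨i, hi⟩| ≤ δ := by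
    intro i
    have hdata := h.isOrderCompatible.isSurvivalData hcol i
    by_cases hi : i ∈ A
    · obtain ⟨μ, hμ, hm, hval, hnear⟩ := hdata.exists_isAdmissibleMarginal_near (a := A)
        (fun hmem => hA𝒮 (Finset.mem_filter.1 hmem).1) (x := x ⟨i, hi⟩) ⟨h.nonneg _, hx1 _⟩
        (fun S hS => h.le_data S (Finset.mem_filter.1 hS).1 ⟨i, hi⟩ (Finset.mem_filter.1 hS).2)
        (fun S hS => h.data_le S (Finset.mem_filter.1 hS).1 ⟨i, hi⟩ (Finset.mem_filter.1 hS).2)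
        hδpos
      exact ⟨μ, hμ, hm, hval, fun _ => hnear⟩
    · obtain ⟨μ, hμ, hm, hval⟩ := hdata.exists_isAdmissibleMarginal
      exact ⟨μ, hμ, hm, hval, fun hi' => absurd hi' hi⟩
  choose F hF hone hval hnear using hcurve
  obtain ⟨y, hy, hyabs⟩ := exists_survival_through_data hcol hA hA𝒮 hF hone
    (fun S hS i hi => hval i S (Finset.mem_filter.2 ⟨hS, hi⟩)) (lam A)
  have hdefect : |1 - ∑ i ∈ A, (F i).real (Ioi (lam A))| ≤ A.card * δ := by
    rw [← h.sum_eq_one, ← Finset.sum_coe_sort A, ← Finset.sum_sub_distrib]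
    refine (Finset.abs_sum_le_sum_abs _ _).trans ?_
    refine (Finset.sum_le_card_nsmul _ _ δ fun i _ => ?_).trans_eq (by simp)
    rw [abs_sub_comm]
    exact hnear i i.2
  refine ⟨y, hy, (dist_pi_lt_iff hε).2 fun i => ?_⟩
  rw [dist_comm, Real.dist_eq]
  have hε' : ε = (A.card + 2) * δ := by rw [hδ, mul_div_cancel₀ _ hcard.ne']
  calc |y i - x i| ≤ |y i - (F i).real (Ioi (lam A))| + |(F i).real (Ioi (lam A)) - x i| :=
        abs_sub_le _ _ _
    _ ≤ A.card * δ + δ := add_le_add ((hyabs i).trans hdefect) (hnear i i.2)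
    _ < ε := by rw [hε']; linarith

/-- `lam` constrains `x` only through which `lam S` lie weakly below or above `lam A`. There are
finitely many such patterns, and each one realized by an order compatible `lam` gives a closed
polytope. -/
lemma isClosed_setOf_isFeasible (𝒮 : Finset (Finset (Fin n))) (p : Finset (Fin n) → Fin n → ℝ)
    (A : Finset (Fin n)) : IsClosed {x : A → ℝ | ∃ lam, IsFeasible 𝒮 p A x lam} := by
  classical
  let box : Finset (Finset (Fin n)) × Finset (Finset (Fin n)) → Set (A → ℝ) := fun c =>
    (⋂ S ∈ c.1, ⋂ i : A, ⋂ _ : (i : Fin n) ∈ S, {x | x i ≤ p S i}) ∩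
    (⋂ S ∈ c.2, ⋂ i : A, ⋂ _ : (i : Fin n) ∈ S, {x | p S i ≤ x i}) ∩
    ({x | ∑ i, x i = 1} ∩ ⋂ i, {x | 0 ≤ x i})
  let sides : (Finset (Fin n) → ℝ) → Finset (Finset (Fin n)) × Finset (Finset (Fin n)) :=
    fun lam => (𝒮.filter fun S => lam S ≤ lam A, 𝒮.filter fun S => lam A ≤ lam S)
  have hbox : ∀ c, IsClosed (box c) := by
    intro c
    refine ((isClosed_biInter fun S _ => isClosed_iInter fun i => isClosed_iInter fun _ => ?_).inter
      (isClosed_biInter fun S _ => isClosed_iInter fun i => isClosed_iInter fun _ => ?_)).inter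
      (IsClosed.inter ?_ (isClosed_iInter fun i => ?_))
    · exact isClosed_le (continuous_apply i) continuous_const
    · exact isClosed_le continuous_const (continuous_apply i)
    · exact isClosed_eq (continuous_finsetSum _ fun i _ => continuous_apply i) continuous_const
    · exact isClosed_le continuous_const (continuous_apply i)
  have heq : {x : A → ℝ | ∃ lam, IsFeasible 𝒮 p A x lam} =
      ⋃ c ∈ sides '' {lam | IsOrderCompatible 𝒮 p lam}, box c := by
    ext x
    simp only [mem_ofPred_eq, mem_iUnion, mem_image, exists_prop, exists_exists_and_eq_and]
    refine exists_congr fun lam => ⟨fun h => ⟨h.isOrderCompatible, ?_⟩, fun ⟨hlam, h⟩ => ?_⟩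
    · refine ⟨⟨?_, ?_⟩, h.sum_eq_one, mem_iInter.2 h.nonneg⟩
      · simp only [sides, mem_iInter, Finset.mem_filter]
        exact fun S hS i hi => h.le_data S hS.1 i hi hS.2
      · simp only [sides, mem_iInter, Finset.mem_filter]
        exact fun S hS i hi => h.data_le S hS.1 i hi hS.2
    · obtain ⟨⟨h1, h2⟩, h3, h4⟩ := h
      simp only [sides, mem_iInter, Finset.mem_filter] at h1 h2 h4
      exact ⟨fun S hS i hi hle => h1 S ⟨hS, hle⟩ i hi, fun S hS i hi hle => h2 S ⟨hS, hle⟩ i hi,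
        h3, h4, hlam.lam_lt, hlam.lam_eq⟩
  rw [heq]
  refine Set.Finite.isClosed_biUnion (Set.Finite.subset (Set.finite_univ) (subset_univ _))
    fun c _ => hbox c

lemma closure_consistentSet (hcol : IsChoiceCollection 𝒮 p) (hA : A.Nonempty) (hA𝒮 : A ∉ 𝒮) :
    closure (consistentSet 𝒮 p A) = {x : A → ℝ | ∃ lam, IsFeasible 𝒮 p A x lam} :=
  Subset.antisymm
    (closure_minimal (fun _ hx => exists_isFeasible_of_mem_consistentSet hA𝒮 hx)
      (isClosed_setOf_isFeasible 𝒮 p A))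
    (fun _ ⟨_, h⟩ => h.mem_closure hcol hA hA𝒮)

lemma isCompact_closure_consistentSet (𝒮 : Finset (Finset (Fin n)))
    (p : Finset (Fin n) → Fin n → ℝ) (A : Finset (Fin n)) :
    IsCompact (closure (consistentSet 𝒮 p A)) := by
  refine isCompact_Icc.closure_of_subset (K := Icc (0 : A → ℝ) 1) fun x hx => ?_
  have hcol : IsChoiceCollection (insert A 𝒮) (extendData p A x) := hx.1
  have h : ∀ i : A, x i ∈ Icc (0 : ℝ) 1 := fun i => by
    rw [← extendData_self (p := p) x i]
    exact hcol.mem_Icc (Finset.mem_insert_self A 𝒮) i.2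
  exact ⟨fun i => (h i).1, fun i => (h i).2⟩

lemma continuous_revenue (r : Fin n → ℝ) (A : Finset (Fin n)) : Continuous (revenue r A) :=
  continuous_finsetSum _ fun i _ => continuous_const.mul (continuous_apply i)

end Extension

theorem proposition1 {n : ℕ} (𝒮 : Finset (Finset (Fin n))) (p : Finset (Fin n) → Fin n → ℝ)
    (hp : IsMDMRepresentable 𝒮 p) (A : Finset (Fin n)) (hA : A.Nonempty) (hA𝒮 : A ∉ 𝒮)
    (r : Fin n → ℝ) (hr : ∀ i, 0 < r i) :
    IsGLB (revenue r A '' consistentSet 𝒮 p A) (worstCaseRevenue 𝒮 p r A) ∧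
      IsLeast {v : ℝ | ∃ (x : A → ℝ) (lam : Finset (Fin n) → ℝ),
        IsFeasible 𝒮 p A x lam ∧ v = revenue r A x} (worstCaseRevenue 𝒮 p r A) ∧
      closure (consistentSet 𝒮 p A) =
        {x : A → ℝ | ∃ lam : Finset (Fin n) → ℝ, IsFeasible 𝒮 p A x lam} := by
  have hne := consistentSet_nonempty hp hA hA𝒮
  have hclos := closure_consistentSet hp.1 hA hA𝒮
  have hcomp := isCompact_closure_consistentSet 𝒮 p A
  have hcont := continuous_revenue r A
  have hbdd : BddBelow (revenue r A '' consistentSet 𝒮 p A) :=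
    (hcomp.image hcont).bddBelow.mono (image_mono subset_closure)
  have hglb : IsGLB (revenue r A '' consistentSet 𝒮 p A) (worstCaseRevenue 𝒮 p r A) :=
    isGLB_csInf (hne.image _) hbdd
  -- A lower bound for a continuous function passes to the closure.
  have hlow : ∀ x ∈ closure (consistentSet 𝒮 p A), worstCaseRevenue 𝒮 p r A ≤ revenue r A x :=
    closure_minimal (fun x hx => hglb.1 (mem_image_of_mem _ hx))
      (isClosed_le continuous_const hcont)
  refine ⟨hglb, ⟨?_, ?_⟩, hclos⟩
  · obtain ⟨x, hx, hmin⟩ := hcomp.exists_isMinOn hne.closure hcont.continuousOn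
    have hx' := hx
    rw [hclos] at hx'
    obtain ⟨lam, hlam⟩ := hx'
    refine ⟨x, lam, hlam, le_antisymm (hlow x hx) (hglb.2 ?_)⟩
    rintro _ ⟨y, hy, rfl⟩
    exact hmin (subset_closure hy)
  · rintro _ ⟨x, lam, hlam, rfl⟩
    refine hlow x ?_
    rw [hclos]
    exact ⟨lam, hlam⟩
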